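/- Let $\Sigma$ be a connected compact Riemann surface with nonempty boundary $S$, equipped with a spin structure, i.e. a holomorphic square root $L$ of the canonical bundle. The $\mathbb C^2$-valued spinors along $S$ (sections of $L|_S\otimes\mathbb C^2$) that are square integrable with respect to the intrinsic density $|\psi|^2=|\psi_z|^2|dz|$ (for $\psi=\psi_z\,(dz)^{1/2}$) form a Hilbert space $\mathcal H$. Let $\mathcal H^+\subset\mathcal H$ be the closed subspace of $L^2$ boundary values of holomorphic spinors on the interior of $\Sigma$, let $P_+$ be the orthogonal projection onto $\mathcal H^+$, and $P_-=1-P_+$. For a bounded measurable $g:S\to M_2(\mathbb C)$ let $M_g$ be multiplication by $g$ on $\mathcal H$, and put $A(g)=P_+M_gP_+$ (the spin Toeplitz operator), $B(g)=P_+M_gP_-$ and $C(g)=P_-M_gP_+$. Suppose that $g_1,g_2\in L^\infty(S,SL(2,\mathbb C))$ are of the form $$g_1=\begin{pmatrix} a_1&b_1\\ \tilde c_1&\tilde d_1\end{pmatrix},\qquad g_2=\begin{pmatrix}\tilde a_2&\tilde b_2\\ c_2&d_2\end{pmatrix},$$ where each of $a_1,b_1,c_2,d_2$ is almost everywhere on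 $S$ the boundary value of a bounded holomorphic function on the interior of $\Sigma$ (no additional conditions are imposed on $\tilde c_1,\tilde d_1,\tilde a_2,\tilde b_2$). Let $g_1^*$ be the pointwise Hermitian adjoint of $g_1$. Then $$A(g_1^*g_2)=A(g_1^*)A(g_2)\qquad\text{and}\qquad B(g_1^*)C(g_2)=0 .$$ The same holds when $P_+$ is replaced throughout by the bounded projection with range $\mathcal H^+$ and kernel $\mathcal H^-$, whenever such a projection exists, where $\mathcal H^-$ is the closed subspace of $L^2$ boundary values of holomorphic spinors on the conjugate surface $\Sigma^*$ (the other half of the double of $\Sigma$, with the induced reflection-symmetric spin structure, for which the spin bundles of $\Sigma$ and $\Sigma^*$ are identified along $S$ through local coordinates that are real on $S$). -/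

import Mathlib

open Set Filter Topology MeasureTheory
open scoped Manifold ContDiff ENNReal Matrix ComplexConjugate

noncomputable section

/-- The closed upper half-plane, the local model of a Riemann surface with boundary. -/
abbrev ClosedHalfPlane : Type := {z : ℂ // 0 ≤ z.im}

/-- The closed upper half-plane as a complex model with boundary `{Im z = 0}`. A Riemann surface
with boundary is a manifold with this model and analytic transition functions (they are holomorphic
across the boundary, by the reflection principle). -/
def halfPlaneModel : ModelWithCorners ℂ ℂ ClosedHalfPlane where
  toFun := Subtype.val
  invFun z := ⟨⟨z.re, max z.im 0⟩, le_max_right _ _⟩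
  source := univ
  target := {z | 0 ≤ z.im}
  map_source' z _ := z.property
  map_target' _ _ := mem_univ _
  left_inv' := by
    rintro ⟨z, hz⟩ _
    exact Subtype.ext (Complex.ext rfl (max_eq_left hz))
  right_inv' := by
    intro z hz
    exact Complex.ext rfl (max_eq_left hz)
  source_eq := rfl
  convex_range' := by
    simp only [instIsRCLikeNormedField, ↓reduceDIte]
    apply Convex.convex_isRCLikeNormedField
    have h : range (Subtype.val : ClosedHalfPlane → ℂ) = {z : ℂ | 0 ≤ z.im} := Subtype.range_val
    exact h ▸ convex_halfSpace_im_ge 0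
  nonempty_interior' := by
    have h : range (Subtype.val : ClosedHalfPlane → ℂ) = {z : ℂ | 0 ≤ z.im} := Subtype.range_val
    change (interior (range (Subtype.val : ClosedHalfPlane → ℂ))).Nonempty
    refine h ▸ ⟨Complex.I, mem_interior.2 ⟨{z : ℂ | 0 < z.im}, fun z (hz : 0 < z.im) => hz.le,
      isOpen_lt continuous_const Complex.continuous_im, by simp⟩⟩
  continuous_toFun := continuous_subtype_val
  continuous_invFun := by
    refine Continuous.subtype_mk ?_ _
    have h : Continuous fun z : ℂ => ((z.re : ℂ) + ((max z.im 0 : ℝ) : ℂ) * Complex.I) := by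
      fun_prop
    refine h.congr fun z => ?_
    apply Complex.ext <;> simp

/-- A spin structure: a holomorphic square root `L` of the canonical bundle of `Y`, given by finitely
many trivialising charts `zᵢ` covering `Y` and transition functions `sᵢⱼ` with `sᵢⱼ² = dzⱼ/dzᵢ` and
the cocycle property. In the chart `zᵢ` a section of `L` is written `ψᵢ (dzᵢ)^{1/2}`, and
`ψᵢ = sᵢⱼ ψⱼ` on overlaps. (A continuous square root of a holomorphic function is holomorphic.) -/
structure SpinStructure (Y : Type*) [TopologicalSpace Y] [ChartedSpace ClosedHalfPlane Y] where
  /-- the number of charts -/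
  n : ℕ
  /-- the charts -/
  chart : Fin n → OpenPartialHomeomorph Y ClosedHalfPlane
  chart_mem : ∀ i, chart i ∈ IsManifold.maximalAtlas halfPlaneModel ω Y
  cover : ∀ x, ∃ i, x ∈ (chart i).source
  /-- the transition functions `(dzⱼ/dzᵢ)^{1/2}` -/
  s : Fin n → Fin n → Y → ℂ
  s_continuousOn : ∀ i j, ContinuousOn (s i j) ((chart i).source ∩ (chart j).source)
  s_sq : ∀ i j, ∀ x ∈ (chart i).source ∩ (chart j).source,
    s i j x ^ 2 = derivWithin
      ((chart j).extend halfPlaneModel ∘ ((chart i).extend halfPlaneModel).symm)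
      (range halfPlaneModel) ((chart i).extend halfPlaneModel x)
  s_cocycle : ∀ i j k, ∀ x ∈ (chart i).source ∩ (chart j).source ∩ (chart k).source,
    s i j x * s j k x = s i k x

namespace SpinStructure

section

variable {Y : Type*} [TopologicalSpace Y] [ChartedSpace ClosedHalfPlane Y] (S : SpinStructure Y)

/-- The part of the closed half-plane parametrised by the chart `zᵢ`, as a subset of `ℂ`. -/
def dom (i : Fin S.n) : Set ℂ := ((S.chart i).extend halfPlaneModel).target

/-- The point of the surface with coordinate `zᵢ = z`. -/
def pt (i : Fin S.n) (z : ℂ) : Y := ((S.chart i).extend halfPlaneModel).symm z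

open Classical in
/-- The first chart that contains `x`. Spinors along the boundary are recorded at `x` by their
component in this chart. -/
def idx (x : Y) : Fin S.n := Fin.find (fun i => x ∈ (S.chart i).source) (S.cover x)

/-- The component in the chart `zᵢ` of the spinor along the boundary that is recorded by `f`. -/
def comp (f : Y → ℂ) (i : Fin S.n) (x : Y) : ℂ := S.s i (S.idx x) x * f x

/-- `ψ` is (the family of components of) a holomorphic spinor in the interior of the surface. -/
def IsHolomorphicSpinor (ψ : Fin S.n → Y → ℂ) : Prop :=
  (∀ i j, ∀ x ∈ (S.chart i).source ∩ (S.chart j).source, x ∈ halfPlaneModel.interior Y →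
    ψ i x = S.s i j x * ψ j x) ∧
  ∀ i, DifferentiableOn ℂ (fun z => ψ i (S.pt i z)) (S.dom i ∩ {z | 0 < z.im})

/-- The spinor along the boundary recorded by `f` is the `L²` boundary value of `ψ`: in each chart,
`ψᵢ(x + it) → fᵢ(x)` in `L²(K)` as `t ↓ 0`, for all compact sets `K` of boundary points. -/
def IsL2BoundaryValue (ψ : Fin S.n → Y → ℂ) (f : Y → ℂ) : Prop :=
  ∀ i, ∀ K : Set ℝ, IsCompact K → (∀ x ∈ K, (x : ℂ) ∈ S.dom i) →
    Tendsto (fun t : ℝ => eLpNorm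
      (fun x : ℝ => ψ i (S.pt i (x + t * Complex.I)) - S.comp f i (S.pt i x)) 2
      (volume.restrict K)) (𝓝[>] 0) (𝓝 0)

/-- `a` is (almost everywhere on the boundary) the boundary value of a bounded holomorphic function
in the interior of the surface. -/
def IsHolomorphicBoundaryValue (a : Y → ℂ) : Prop :=
  ∃ F : Y → ℂ, MDifferentiableOn halfPlaneModel 𝓘(ℂ) F (halfPlaneModel.interior Y) ∧
    (∃ C : ℝ, ∀ x ∈ halfPlaneModel.interior Y, ‖F x‖ ≤ C) ∧
    ∀ i, ∀ᵐ x : ℝ, (x : ℂ) ∈ S.dom i →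
      Tendsto (fun t : ℝ => F (S.pt i (x + t * Complex.I))) (𝓝[>] 0) (𝓝 (a (S.pt i x)))

variable [MeasurableSpace Y]

/-- The measure on (the boundary of) `Y` that is `|dzᵢ|` where `i` is the first chart containing the
point. For a spinor `ψ`, recorded by `f` as above, `|f|²` times this measure is the intrinsic density
`|ψ|² = |ψᵢ|² |dzᵢ|` on the boundary. -/
def bdryMeasure : Measure Y :=
  Measure.sum fun i => Measure.map (fun x : ℝ => S.pt i x)
    (volume.restrict {x : ℝ | (x : ℂ) ∈ S.dom i ∧ S.idx (S.pt i x) = i})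

/-- The Hilbert space of square integrable `ℂ²`-valued spinors along the boundary. -/
abbrev Spinors : Type _ := Lp (EuclideanSpace ℂ (Fin 2)) 2 S.bdryMeasure

/-- The `ℂ²`-valued spinors along the boundary that are boundary values of holomorphic spinors on
the surface (these already form a closed subspace). -/
def hPlus : Submodule ℂ S.Spinors :=
  (Submodule.span ℂ {f : S.Spinors | ∃ ψ : Fin 2 → Fin S.n → Y → ℂ, ∀ k,
    S.IsHolomorphicSpinor (ψ k) ∧ S.IsL2BoundaryValue (ψ k) (fun x => f x k)}).topologicalClosure

/-- The same for the surface with the conjugate complex structure, that is, for the other half of the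
double: the holomorphic spinors there are the families of complex conjugates of components of
holomorphic spinors on the surface, and the two spin bundles are glued along the boundary, where the
`sᵢⱼ` are real, by equality of components. -/
def hMinus : Submodule ℂ S.Spinors :=
  (Submodule.span ℂ {f : S.Spinors | ∃ ψ : Fin 2 → Fin S.n → Y → ℂ, ∀ k,
    S.IsHolomorphicSpinor (ψ k) ∧
    S.IsL2BoundaryValue (fun i x => conj (ψ k i x)) (fun x => f x k)}).topologicalClosure

/-- The orthogonal projection onto `hPlus`. -/
def projPlus : S.Spinors →L[ℂ] S.Spinors :=
  haveI : CompleteSpace S.hPlus := Submodule.topologicalClosure.completeSpace _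
  S.hPlus.starProjection

/-- `P` is the projection onto the first summand of a polarization `hPlus ⊕ hMinus`. -/
def IsPolarization (P : S.Spinors →L[ℂ] S.Spinors) : Prop :=
  (∀ f, P f ∈ S.hPlus) ∧ (∀ f ∈ S.hPlus, P f = f) ∧ ∀ f, P f = 0 ↔ f ∈ S.hMinus

end

end SpinStructure

/-- Essentially bounded measurable matrix valued functions. -/
structure LInfLoop {Y : Type*} [MeasurableSpace Y] (μ : Measure Y) where
  /-- the matrix valued function -/
  toFun : Y → Matrix (Fin 2) (Fin 2) ℂ
  memLp : ∀ i j, MemLp (fun x => toFun x i j) ∞ μ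

namespace LInfLoop

section

variable {Y : Type*} [MeasurableSpace Y] {μ : Measure Y}

/-- The pointwise Hermitian adjoint. -/
def adj (g : LInfLoop μ) : LInfLoop μ where
  toFun x := (g.toFun x)ᴴ
  memLp i j := (g.memLp j i).star

/-- The pointwise product. -/
def mul (g h : LInfLoop μ) : LInfLoop μ where
  toFun x := g.toFun x * h.toFun x
  memLp i j := by
    simp only [Matrix.mul_apply]
    exact memLp_finsetSum _ fun k _ => MemLp.mul (h.memLp k j) (g.memLp i k)

theorem memLp_linearMap {E : Type*} [NormedAddCommGroup E] [NormedSpace ℂ E] (g : LInfLoop μ)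
    (L : Matrix (Fin 2) (Fin 2) ℂ →ₗ[ℂ] E) : MemLp (fun x => L (g.toFun x)) ∞ μ := by
  have h : (fun x => L (g.toFun x)) =
      fun x => ∑ i, ∑ j, g.toFun x i j • L (Matrix.single i j 1) := by
    funext x
    conv_lhs => rw [Matrix.matrix_eq_sum_single (g.toFun x)]
    simp only [map_sum]
    refine Finset.sum_congr rfl fun i _ => Finset.sum_congr rfl fun j _ => ?_
    rw [← map_smul, Matrix.smul_single, smul_eq_mul, mul_one]
  rw [h]
  refine memLp_finsetSum _ fun i _ => memLp_finsetSum _ fun j _ => ?_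
  exact ((ContinuousLinearMap.id ℂ ℂ).smulRight (L (Matrix.single i j 1))).comp_memLp' (g.memLp i j)

theorem memLp_toEuclideanCLM (g : LInfLoop μ) :
    MemLp (fun x => Matrix.toEuclideanCLM (n := Fin 2) (𝕜 := ℂ) (g.toFun x)) ∞ μ :=
  g.memLp_linearMap
    (Matrix.toEuclideanCLM (n := Fin 2) (𝕜 := ℂ)).toAlgEquiv.toLinearMap

/-- The bounded operator `f ↦ g f` of multiplication by `g` on `L²(μ; ℂ²)`. -/
def mulOp (g : LInfLoop μ) :
    Lp (EuclideanSpace ℂ (Fin 2)) 2 μ →L[ℂ] Lp (EuclideanSpace ℂ (Fin 2)) 2 μ :=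
  ContinuousLinearMap.holderL μ ∞ 2 2
    (ContinuousLinearMap.id ℂ (EuclideanSpace ℂ (Fin 2) →L[ℂ] EuclideanSpace ℂ (Fin 2)))
    g.memLp_toEuclideanCLM.toLp

/-- The block `A(g)` of multiplication by `g`, relative to the projections `P` and `1 - P`. -/
def blockA (P : Lp (EuclideanSpace ℂ (Fin 2)) 2 μ →L[ℂ] Lp (EuclideanSpace ℂ (Fin 2)) 2 μ)
    (g : LInfLoop μ) := P ∘L g.mulOp ∘L P

/-- The block `B(g)` of multiplication by `g`, relative to the projections `P` and `1 - P`. -/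
def blockB (P : Lp (EuclideanSpace ℂ (Fin 2)) 2 μ →L[ℂ] Lp (EuclideanSpace ℂ (Fin 2)) 2 μ)
    (g : LInfLoop μ) := P ∘L g.mulOp ∘L (1 - P)

/-- The block `C(g)` of multiplication by `g`, relative to the projections `P` and `1 - P`. -/
def blockC (P : Lp (EuclideanSpace ℂ (Fin 2)) 2 μ →L[ℂ] Lp (EuclideanSpace ℂ (Fin 2)) 2 μ)
    (g : LInfLoop μ) := (1 - P) ∘L g.mulOp ∘L P

end

end LInfLoop

end

/-! Write `P` for the projection and `V` for its range. Since `P² = P`, both claims say the same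
thing: `P g₁* v = 0` for `v = (1 - P) g₂ u` and `u ∈ V`. Two facts about a matrix `h` with bounded
holomorphic entries suffice: `h` preserves `V`, and `h*` preserves `ker P`. Applied to the
self-adjoint constant `diag(0,1)`, they show that `P` commutes with taking the second component. The
second component of `g₂ u` involves only `c₂, d₂`, so it already lies in `V` and the second
component of `v` vanishes. Hence `g₁* v` involves only the conjugates of `a₁, b₁`: it equals `h* v`,
where `h` is `g₁` with its second row replaced by zero. As `h` is holomorphic and `P v = 0`, also `P
h* v = 0`. This is `blockA_adj_mul_and_blockB_blockC`. The analytic input is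
`IsL2BoundaryValue.mul`: a bounded holomorphic function with almost everywhere boundary values,
times a holomorphic spinor with `L²` boundary values, has the product as `L²` boundary value. This
gives the first fact for `hPlus` and, after conjugation, the second for `hMinus`. For the orthogonal
projection the second fact is the adjoint of the first. -/

/-- Being an interior point can be tested in any chart of the maximal atlas. -/
theorem isInteriorPoint_iff_of_mem_maximalAtlas {𝕜 : Type*} [NontriviallyNormedField 𝕜]
    {E : Type*} [NormedAddCommGroup E] [NormedSpace 𝕜 E] {H : Type*} [TopologicalSpace H]
    {I : ModelWithCorners 𝕜 E H} {M : Type*} [TopologicalSpace M] [ChartedSpace H M]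
    {n : WithTop ℕ∞} [IsManifold I n M] (hn : n ≠ 0) {e : OpenPartialHomeomorph M H}
    (he : e ∈ IsManifold.maximalAtlas I n M) {x : M} (hx : x ∈ e.source) :
    I.IsInteriorPoint x ↔ e.extend I x ∈ interior (range I) := by
  have h : IsLocalDiffeomorphAt I I n e x :=
    ⟨{ toPartialEquiv := e.toPartialEquiv
       open_source := e.open_source
       open_target := e.open_target
       contMDiffOn_toFun := contMDiffOn_of_mem_maximalAtlas he
       contMDiffOn_invFun := contMDiffOn_symm_of_mem_maximalAtlas he }, hx, fun _ _ => rfl⟩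
  rw [h.isInteriorPoint_iff hn, ModelWithCorners.IsInteriorPoint, extChartAt_self_eq]
  rfl

theorem range_halfPlaneModel : range halfPlaneModel = {z : ℂ | 0 ≤ z.im} := Subtype.range_val

/-! ### Charts near the boundary and null sets of the boundary measure. -/

namespace SpinStructure

section

variable {Y : Type*} [TopologicalSpace Y] [ChartedSpace ClosedHalfPlane Y] (S : SpinStructure Y)

theorem mem_interior_iff [IsManifold halfPlaneModel ω Y] {i : Fin S.n} {x : Y}
    (hx : x ∈ (S.chart i).source) :
    x ∈ halfPlaneModel.interior Y ↔ 0 < ((S.chart i).extend halfPlaneModel x).im := by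
  change halfPlaneModel.IsInteriorPoint x ↔ _
  rw [isInteriorPoint_iff_of_mem_maximalAtlas (n := ω) (by simp) (S.chart_mem i) hx,
    range_halfPlaneModel, Complex.interior_setOfPred_le_im]
  rfl

theorem pt_mem_source {i : Fin S.n} {z : ℂ} (hz : z ∈ S.dom i) :
    S.pt i z ∈ (S.chart i).source := by
  rw [← (S.chart i).extend_source (I := halfPlaneModel)]
  exact PartialEquiv.map_target _ hz

theorem extend_pt {i : Fin S.n} {z : ℂ} (hz : z ∈ S.dom i) :
    (S.chart i).extend halfPlaneModel (S.pt i z) = z :=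
  PartialEquiv.right_inv _ hz

theorem pt_extend {i : Fin S.n} {x : Y} (hx : x ∈ (S.chart i).source) :
    S.pt i ((S.chart i).extend halfPlaneModel x) = x :=
  (S.chart i).extend_left_inv hx

theorem extend_mem_dom {i : Fin S.n} {x : Y} (hx : x ∈ (S.chart i).source) :
    (S.chart i).extend halfPlaneModel x ∈ S.dom i :=
  PartialEquiv.map_source _ ((S.chart i).extend_source (I := halfPlaneModel) ▸ hx)

theorem pt_mem_interior_iff [IsManifold halfPlaneModel ω Y] {i : Fin S.n} {z : ℂ}
    (hz : z ∈ S.dom i) : S.pt i z ∈ halfPlaneModel.interior Y ↔ 0 < z.im := by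
  rw [S.mem_interior_iff (S.pt_mem_source hz), S.extend_pt hz]

theorem continuousOn_pt (i : Fin S.n) : ContinuousOn (S.pt i) (S.dom i) :=
  (S.chart i).continuousOn_extend_symm

theorem contMDiffOn_pt [IsManifold halfPlaneModel ω Y] (i : Fin S.n) :
    ContMDiffOn 𝓘(ℂ) halfPlaneModel ω (S.pt i) (S.dom i) := by
  have h := contMDiffOn_extend_symm (S.chart_mem i)
  rwa [← OpenPartialHomeomorph.extend_target'] at h

theorem exists_isOpen_dom_eq (i : Fin S.n) :
    ∃ U : Set ℂ, IsOpen U ∧ S.dom i = U ∩ {z | 0 ≤ z.im} := by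
  refine ⟨halfPlaneModel.symm ⁻¹' (S.chart i).target,
    (S.chart i).open_target.preimage halfPlaneModel.continuous_symm, ?_⟩
  rw [dom, OpenPartialHomeomorph.extend_target, range_halfPlaneModel]

/-- The boundary points in the domain of the chart `zᵢ`. -/
def bdryDom (i : Fin S.n) : Set ℝ := {x : ℝ | (x : ℂ) ∈ S.dom i}

theorem isOpen_bdryDom (i : Fin S.n) : IsOpen (S.bdryDom i) := by
  obtain ⟨U, hU, h⟩ := S.exists_isOpen_dom_eq i
  have : S.bdryDom i = (fun x : ℝ => (x : ℂ)) ⁻¹' U := by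
    ext x; simp [bdryDom, h]
  rw [this]
  exact hU.preimage Complex.continuous_ofReal

theorem continuousOn_pt_ofReal (i : Fin S.n) :
    ContinuousOn (fun x : ℝ => S.pt i x) (S.bdryDom i) :=
  (S.continuousOn_pt i).comp Complex.continuous_ofReal.continuousOn fun _ hx => hx

/-- Compactness of `K` gives one height `t` that works for all its points, so the shifted functions
in the definition of boundary values live in the interior for small `t`. -/
theorem eventually_add_mem_dom {i : Fin S.n} {K : Set ℝ} (hK : IsCompact K)
    (hKi : K ⊆ S.bdryDom i) :
    ∀ᶠ t : ℝ in 𝓝[>] 0, ∀ x ∈ K,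
      (x : ℂ) + t * Complex.I ∈ S.dom i ∩ {z | 0 < z.im} := by
  obtain ⟨U, hU, h⟩ := S.exists_isOpen_dom_eq i
  have h1 : ∀ᶠ t : ℝ in 𝓝 0, ∀ x ∈ K, (x : ℂ) + t * Complex.I ∈ U := by
    refine hK.eventually_forall_of_forall_eventually fun x hx => ?_
    have hc : Continuous fun p : ℝ × ℝ => (p.2 : ℂ) + p.1 * Complex.I := by fun_prop
    refine hc.continuousAt.eventually_mem (hU.mem_nhds ?_)
    have : (x : ℂ) ∈ S.dom i := hKi hx
    rw [h] at this
    simpa using this.1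
  filter_upwards [nhdsWithin_le_nhds h1, self_mem_nhdsWithin] with t ht ht0 x hx
  have ht0 : 0 < t := ht0
  rw [h]
  exact ⟨⟨ht x hx, by simpa using ht0.le⟩, by simpa using ht0⟩

theorem idx_eq_iff (x : Y) (i : Fin S.n) :
    S.idx x = i ↔ x ∈ (S.chart i).source ∧ ∀ j < i, x ∉ (S.chart j).source := by
  classical
  exact Fin.find_eq_iff _

theorem mem_source_idx (x : Y) : x ∈ (S.chart (S.idx x)).source :=
  ((S.idx_eq_iff x _).1 rfl).1

theorem isOpen_bdryDom_inter (i j : Fin S.n) :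
    IsOpen {x : ℝ | x ∈ S.bdryDom i ∧ S.pt i x ∈ (S.chart j).source} :=
  (S.continuousOn_pt_ofReal i).isOpen_inter_preimage (S.isOpen_bdryDom i) (S.chart j).open_source

theorem measurableSet_idx_eq (i j : Fin S.n) :
    MeasurableSet {x : ℝ | x ∈ S.bdryDom i ∧ S.idx (S.pt i x) = j} := by
  have : {x : ℝ | x ∈ S.bdryDom i ∧ S.idx (S.pt i x) = j} =
      {x : ℝ | x ∈ S.bdryDom i ∧ S.pt i x ∈ (S.chart j).source} \
        ⋃ k : Fin S.n, ⋃ _ : k < j,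
          {x : ℝ | x ∈ S.bdryDom i ∧ S.pt i x ∈ (S.chart k).source} := by
    ext x
    simp only [idx_eq_iff, mem_ofPred_eq, Set.mem_sdiff, mem_iUnion, not_exists, not_and]
    tauto
  rw [this]
  exact (S.isOpen_bdryDom_inter i j).measurableSet.diff
    (MeasurableSet.iUnion fun k => MeasurableSet.iUnion fun _ =>
      (S.isOpen_bdryDom_inter i k).measurableSet)

variable [MeasurableSpace Y]

theorem aemeasurable_pt [BorelSpace Y] (i : Fin S.n) :
    AEMeasurable (fun x : ℝ => S.pt i x) (volume.restrict (S.bdryDom i)) :=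
  (S.continuousOn_pt_ofReal i).aemeasurable (S.isOpen_bdryDom i).measurableSet

theorem volume_eq_zero_of_ae_bdryMeasure [BorelSpace Y] {p : Y → Prop}
    (h : ∀ᵐ y ∂S.bdryMeasure, p y) (j : Fin S.n) :
    volume {x : ℝ | x ∈ S.bdryDom j ∧ S.idx (S.pt j x) = j ∧ ¬ p (S.pt j x)} = 0 := by
  rw [bdryMeasure, Measure.ae_sum_iff] at h
  have h1 := ae_of_ae_map ((S.aemeasurable_pt j).mono_measure
    (Measure.restrict_mono (fun x hx => hx.1) le_rfl)) (h j)
  rw [ae_iff] at h1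
  -- This bound on a restricted measure holds for arbitrary sets, so `p` need not be measurable.
  refine measure_mono_null ?_ (le_antisymm ((Measure.le_restrict_apply _ _).trans h1.le) bot_le)
  exact fun x hx => ⟨hx.2.2, hx.1, hx.2.1⟩

/-- `bdryMeasure` sees a boundary point only in its first chart. The exceptional set in the chart
`zᵢ` is covered by finitely many images of null sets under coordinate changes, which are
differentiable and hence preserve null sets. -/
theorem ae_pt_of_ae_bdryMeasure [IsManifold halfPlaneModel ω Y] [BorelSpace Y] {p : Y → Prop}
    (h : ∀ᵐ y ∂S.bdryMeasure, p y) (i : Fin S.n) :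
    ∀ᵐ x : ℝ, x ∈ S.bdryDom i → p (S.pt i x) := by
  set φ : Fin S.n → ℝ → ℝ := fun j x => ((S.chart i).extend halfPlaneModel (S.pt j x)).re with hφ
  set N : Fin S.n → Set ℝ := fun j =>
    {x : ℝ | x ∈ S.bdryDom j ∧ S.idx (S.pt j x) = j ∧ ¬ p (S.pt j x)} ∩
      {x : ℝ | S.pt j x ∈ (S.chart i).source} with hN
  have hnull : ∀ j, volume (φ j '' N j) = 0 := fun j => by
    refine addHaar_image_eq_zero_of_differentiableOn_of_addHaar_eq_zero _ ?_
      (measure_mono_null inter_subset_left (S.volume_eq_zero_of_ae_bdryMeasure h j))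
    have h1 := (halfPlaneModel.contDiffOn_extendCoordChange (S.chart_mem j)
      (S.chart_mem i)).differentiableOn (by simp)
    have h2 := (h1.restrictScalars ℝ).comp (t := halfPlaneModel.extendCoordChange
      (S.chart j) (S.chart i) |>.source) (s := N j) Complex.ofRealCLM.differentiable.differentiableOn
      fun x hx => ⟨hx.1.1, by
        rw [OpenPartialHomeomorph.extend_source]
        exact hx.2⟩
    exact Complex.reCLM.differentiable.comp_differentiableOn h2
  refine measure_mono_null ?_ (measure_iUnion_null hnull)
  intro x hx
  obtain ⟨hxi, hxp⟩ : x ∈ S.bdryDom i ∧ ¬ p (S.pt i x) := by simpa using hx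
  set y := S.pt i x with hy
  set j := S.idx y with hj
  have hys : y ∈ (S.chart i).source := S.pt_mem_source hxi
  have hyj : y ∈ (S.chart j).source := S.mem_source_idx y
  set w := (S.chart j).extend halfPlaneModel y with hw
  have hwd : w ∈ S.dom j := S.extend_mem_dom hyj
  have hwim : w.im = 0 := by
    -- Whether a point is interior does not depend on the chart, so a real coordinate in `zᵢ` forces
    -- a real coordinate in `zⱼ`.
    have h0 : ¬ 0 < w.im := by
      rw [← S.mem_interior_iff hyj, S.pt_mem_interior_iff hxi]
      simp
    obtain ⟨U, _, hU⟩ := S.exists_isOpen_dom_eq j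
    have h1 : 0 ≤ w.im := (hU ▸ hwd).2
    exact le_antisymm (not_lt.1 h0) h1
  have hwre : ((w.re : ℝ) : ℂ) = w := by apply Complex.ext <;> simp [hwim]
  have hpt : S.pt j (w.re : ℝ) = y := by rw [hwre]; exact S.pt_extend hyj
  refine mem_iUnion.2 ⟨j, w.re, ⟨⟨?_, ?_, ?_⟩, ?_⟩, ?_⟩
  · change ((w.re : ℝ) : ℂ) ∈ S.dom j
    rwa [hwre]
  · rw [hpt]
  · rwa [hpt]
  · change S.pt j (w.re : ℝ) ∈ (S.chart i).source
    rwa [hpt]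
  · simp only [hφ]
    rw [hpt, hy, S.extend_pt hxi, Complex.ofReal_re]

theorem aestronglyMeasurable_comp [IsManifold halfPlaneModel ω Y] [BorelSpace Y] {f : Y → ℂ}
    (hf : AEStronglyMeasurable f S.bdryMeasure) (i : Fin S.n) :
    AEStronglyMeasurable (fun x : ℝ => S.comp f i (S.pt i x))
      (volume.restrict (S.bdryDom i)) := by
  have hf1 : AEStronglyMeasurable (fun x : ℝ => f (S.pt i x)) (volume.restrict (S.bdryDom i)) := by
    have h1 : AEMeasurable (fun x : ℝ => hf.mk f (S.pt i x)) (volume.restrict (S.bdryDom i)) :=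
      hf.stronglyMeasurable_mk.measurable.comp_aemeasurable (S.aemeasurable_pt i)
    refine h1.aestronglyMeasurable.congr ?_
    rw [Filter.EventuallyEq, ae_restrict_iff' (S.isOpen_bdryDom i).measurableSet]
    filter_upwards [S.ae_pt_of_ae_bdryMeasure hf.ae_eq_mk i] with x hx hxi using (hx hxi).symm
  have hs : AEStronglyMeasurable (fun x : ℝ => S.s i (S.idx (S.pt i x)) (S.pt i x))
      (volume.restrict (S.bdryDom i)) := by
    -- The first-chart index jumps, but it is constant on finitely many measurable pieces, and on
    -- each of them the transition function is continuous.
    have hU : S.bdryDom i = ⋃ j, {x : ℝ | x ∈ S.bdryDom i ∧ S.idx (S.pt i x) = j} := by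
      ext x; simp
    rw [hU, aestronglyMeasurable_iUnion_iff]
    intro j
    have hc : ContinuousOn (fun x : ℝ => S.s i j (S.pt i x))
        {x : ℝ | x ∈ S.bdryDom i ∧ S.pt i x ∈ (S.chart j).source} :=
      (S.s_continuousOn i j).comp ((S.continuousOn_pt_ofReal i).mono fun x hx => hx.1)
        fun x (hx : x ∈ S.bdryDom i ∧ S.pt i x ∈ (S.chart j).source) =>
          ⟨S.pt_mem_source hx.1, hx.2⟩
    have hsub : {x : ℝ | x ∈ S.bdryDom i ∧ S.idx (S.pt i x) = j} ⊆
        {x : ℝ | x ∈ S.bdryDom i ∧ S.pt i x ∈ (S.chart j).source} := by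
      rintro x ⟨hx, rfl⟩
      exact ⟨hx, S.mem_source_idx _⟩
    have hm := (hc.aestronglyMeasurable (μ := volume)
      (S.isOpen_bdryDom_inter i j).measurableSet).mono_measure (Measure.restrict_mono hsub le_rfl)
    refine hm.congr ?_
    filter_upwards [ae_restrict_mem (S.measurableSet_idx_eq i j)] with x hx
    rw [hx.2]
  exact hs.mul hf1

end

end SpinStructure

/-! ### Products of convergent families in `Lᵖ`. -/

theorem tendsto_eLpNorm_zero_of_dominated {α E F ι : Type*} [MeasurableSpace α] {μ : Measure α}
    [NormedAddCommGroup E] [NormedAddCommGroup F] {l : Filter ι} [l.IsCountablyGenerated]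
    {p : ℝ≥0∞} (hp0 : p ≠ 0) (hp : p ≠ ⊤) {u : ι → α → E} {g : α → F}
    (hu : ∀ᶠ n in l, AEStronglyMeasurable (u n) μ) (hg : eLpNorm g p μ < ⊤)
    (hle : ∀ᶠ n in l, ∀ᵐ x ∂μ, ‖u n x‖ ≤ ‖g x‖)
    (hlim : ∀ᵐ x ∂μ, Tendsto (fun n => u n x) l (𝓝 0)) :
    Tendsto (fun n => eLpNorm (u n) p μ) l (𝓝 0) := by
  have hpos : 0 < p.toReal := ENNReal.toReal_pos hp0 hp
  have h1 : Tendsto (fun n => ∫⁻ x, ‖u n x‖ₑ ^ p.toReal ∂μ) l (𝓝 (∫⁻ _, 0 ∂μ)) := by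
    refine tendsto_lintegral_filter_of_dominated_convergence' (fun x => ‖g x‖ₑ ^ p.toReal)
      ?_ ?_ ?_ ?_
    · filter_upwards [hu] with n hn using hn.enorm.pow_const _
    · filter_upwards [hle] with n hn
      filter_upwards [hn] with x hx
      exact ENNReal.rpow_le_rpow (enorm_le_iff_norm_le.2 hx) hpos.le
    · exact (lintegral_rpow_enorm_lt_top_of_eLpNorm_lt_top hp0 hp hg).ne
    · filter_upwards [hlim] with x hx
      have h2 := (ENNReal.continuous_rpow_const (y := p.toReal)).tendsto _ |>.comp hx.enorm
      simpa [hpos, Function.comp_def] using h2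
  have h3 := (ENNReal.continuous_rpow_const (y := 1 / p.toReal)).tendsto _ |>.comp h1
  simp only [eLpNorm_eq_lintegral_rpow_enorm_toReal hp0 hp]
  simpa [hpos, Function.comp_def] using h3

/-- If `u n → f` in `Lᵖ`, and the `m n` are uniformly bounded and converge almost everywhere to `a`,
then `m n * u n → a * f` in `Lᵖ`. -/
theorem tendsto_eLpNorm_mul_sub_mul {α ι : Type*} [MeasurableSpace α] {μ : Measure α}
    {l : Filter ι} [l.IsCountablyGenerated] [l.NeBot] {p : ℝ≥0∞} (hp1 : 1 ≤ p) (hp : p ≠ ⊤)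
    {m u : ι → α → ℂ} {a f : α → ℂ} {C : ℝ}
    (hm : ∀ᶠ n in l, AEStronglyMeasurable (m n) μ) (hu : ∀ᶠ n in l, AEStronglyMeasurable (u n) μ)
    (hf : MemLp f p μ) (hC : ∀ᶠ n in l, ∀ᵐ x ∂μ, ‖m n x‖ ≤ C) (haC : ∀ᵐ x ∂μ, ‖a x‖ ≤ C)
    (hma : ∀ᵐ x ∂μ, Tendsto (fun n => m n x) l (𝓝 (a x)))
    (huf : Tendsto (fun n => eLpNorm (fun x => u n x - f x) p μ) l (𝓝 0)) :
    Tendsto (fun n => eLpNorm (fun x => m n x * u n x - a x * f x) p μ) l (𝓝 0) := by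
  -- Measurability of the limit is read off along a sequence tending to `l`, shifted by `N` so that
  -- every term is measurable.
  have ham : AEStronglyMeasurable a μ := by
    obtain ⟨t, ht⟩ := exists_seq_tendsto l
    obtain ⟨N, hN⟩ := eventually_atTop.1 (ht.eventually hm)
    refine aestronglyMeasurable_of_tendsto_ae atTop (f := fun n x => m (t (n + N)) x)
      (fun n => hN _ (Nat.le_add_left _ _)) ?_
    filter_upwards [hma] with x hx
    exact (hx.comp ht).comp (tendsto_add_atTop_nat N)
  -- The splitting is `m u - a f = m (u - f) + (m - a) f`. The first term is controlled by the
  -- uniform bound `C`, the second by dominated convergence with majorant `2 C |f|`.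
  have h1 : Tendsto (fun n => ENNReal.ofReal C * eLpNorm (fun x => u n x - f x) p μ) l (𝓝 0) := by
    simpa using ENNReal.Tendsto.const_mul huf (Or.inr ENNReal.ofReal_ne_top)
  have h2 : Tendsto (fun n => eLpNorm (fun x => (m n x - a x) * f x) p μ) l (𝓝 0) := by
    have hg : MemLp (fun x => (2 * C : ℂ) • f x) p μ := hf.const_smul (2 * C : ℂ)
    refine tendsto_eLpNorm_zero_of_dominated (zero_lt_one.trans_le hp1).ne' hp ?_ hg.2 ?_ ?_
    · filter_upwards [hm] with n hn
      exact (hn.sub ham).mul hf.1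
    · filter_upwards [hC] with n hn
      filter_upwards [haC, hn] with x hx hnx
      have hC0 : 0 ≤ C := (norm_nonneg _).trans hx
      rw [norm_mul, norm_smul]
      refine mul_le_mul_of_nonneg_right ?_ (norm_nonneg _)
      rw [norm_mul, Complex.norm_ofNat, Complex.norm_real, Real.norm_of_nonneg hC0]
      linarith [norm_sub_le (m n x) (a x)]
    · filter_upwards [hma] with x hx
      simpa using (hx.sub_const (a x)).mul_const (f x)
  have hsum := h1.add h2
  rw [add_zero] at hsum
  refine tendsto_of_tendsto_of_tendsto_of_le_of_le' tendsto_const_nhds hsum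
    (.of_forall fun _ => bot_le) ?_
  filter_upwards [hu, hm, hC] with n hun hmn hCn
  have heq : (fun x => m n x * u n x - a x * f x) =
      (fun x => m n x * (u n x - f x)) + fun x => (m n x - a x) * f x := by
    funext x
    simp only [Pi.add_apply]
    ring
  rw [heq]
  refine (eLpNorm_add_le (hmn.mul (hun.sub hf.1)) ((hmn.sub ham).mul hf.1) hp1).trans ?_
  refine add_le_add (eLpNorm_le_mul_eLpNorm_of_ae_le_mul ?_ p) le_rfl
  filter_upwards [hCn] with x hx
  exact (norm_mul_le _ _).trans <| mul_le_mul_of_nonneg_right hx (norm_nonneg _)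

/-! ### Sums and products of `L²` boundary values. -/

namespace SpinStructure

section

variable {Y : Type*} [TopologicalSpace Y] [ChartedSpace ClosedHalfPlane Y] (S : SpinStructure Y)

/-- The components of `ψ` are continuous in the interior of the surface. -/
def IsContinuousInside (ψ : Fin S.n → Y → ℂ) : Prop :=
  ∀ i, ContinuousOn (fun z => ψ i (S.pt i z)) (S.dom i ∩ {z | 0 < z.im})

variable {S}

theorem IsHolomorphicSpinor.isContinuousInside {ψ : Fin S.n → Y → ℂ}
    (h : S.IsHolomorphicSpinor ψ) : S.IsContinuousInside ψ :=
  fun i => (h.2 i).continuousOn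

theorem IsContinuousInside.conj {ψ : Fin S.n → Y → ℂ} (h : S.IsContinuousInside ψ) :
    S.IsContinuousInside fun i x => conj (ψ i x) :=
  fun i => Complex.continuous_conj.comp_continuousOn (h i)

theorem IsContinuousInside.mul {ψ φ : Fin S.n → Y → ℂ} (h : S.IsContinuousInside ψ)
    (h' : S.IsContinuousInside φ) : S.IsContinuousInside fun i x => ψ i x * φ i x :=
  fun i => (h i).mul (h' i)

theorem IsContinuousInside.eventually_continuousOn {ψ : Fin S.n → Y → ℂ}
    (h : S.IsContinuousInside ψ) {i : Fin S.n} {K : Set ℝ} (hK : IsCompact K)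
    (hKi : K ⊆ S.bdryDom i) :
    ∀ᶠ t : ℝ in 𝓝[>] 0, ContinuousOn (fun x : ℝ => ψ i (S.pt i (x + t * Complex.I))) K := by
  filter_upwards [S.eventually_add_mem_dom hK hKi] with t ht
  exact (h i).comp (by fun_prop) ht

theorem IsContinuousInside.eventually_aestronglyMeasurable {ψ : Fin S.n → Y → ℂ}
    (h : S.IsContinuousInside ψ) {i : Fin S.n} {K : Set ℝ} (hK : IsCompact K)
    (hKi : K ⊆ S.bdryDom i) :
    ∀ᶠ t : ℝ in 𝓝[>] 0, AEStronglyMeasurable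
      (fun x : ℝ => ψ i (S.pt i (x + t * Complex.I))) (volume.restrict K) := by
  filter_upwards [h.eventually_continuousOn hK hKi] with t ht
  exact ht.aestronglyMeasurable hK.measurableSet

variable [MeasurableSpace Y] [BorelSpace Y] [IsManifold halfPlaneModel ω Y]

theorem IsL2BoundaryValue.congr {ψ : Fin S.n → Y → ℂ} {f f' : Y → ℂ}
    (h : S.IsL2BoundaryValue ψ f) (hff' : f =ᵐ[S.bdryMeasure] f') :
    S.IsL2BoundaryValue ψ f' := by
  intro i K hK hKi
  refine (h i K hK hKi).congr fun t => eLpNorm_congr_ae ?_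
  rw [Filter.EventuallyEq, ae_restrict_iff' hK.measurableSet]
  filter_upwards [S.ae_pt_of_ae_bdryMeasure hff' i] with x hx hxK
  simp only [comp, hx (hKi x hxK)]

theorem aestronglyMeasurable_comp_restrict {f : Y → ℂ}
    (hf : AEStronglyMeasurable f S.bdryMeasure) {i : Fin S.n} {K : Set ℝ}
    (hKi : K ⊆ S.bdryDom i) :
    AEStronglyMeasurable (fun x : ℝ => S.comp f i (S.pt i x)) (volume.restrict K) :=
  (S.aestronglyMeasurable_comp hf i).mono_measure (Measure.restrict_mono hKi le_rfl)

theorem IsL2BoundaryValue.add {ψ φ : Fin S.n → Y → ℂ} {f g : Y → ℂ}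
    (h : S.IsL2BoundaryValue ψ f) (h' : S.IsL2BoundaryValue φ g)
    (hψ : S.IsContinuousInside ψ) (hφ : S.IsContinuousInside φ)
    (hf : AEStronglyMeasurable f S.bdryMeasure) (hg : AEStronglyMeasurable g S.bdryMeasure) :
    S.IsL2BoundaryValue (fun i x => ψ i x + φ i x) fun x => f x + g x := by
  intro i K hK hKi
  have hsum := (h i K hK hKi).add (h' i K hK hKi)
  rw [add_zero] at hsum
  refine tendsto_of_tendsto_of_tendsto_of_le_of_le' tendsto_const_nhds hsum
    (.of_forall fun _ => bot_le) ?_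
  filter_upwards [hψ.eventually_aestronglyMeasurable hK hKi,
    hφ.eventually_aestronglyMeasurable hK hKi] with t h1 h2
  refine le_trans (le_of_eq ?_) (eLpNorm_add_le
    (h1.sub (aestronglyMeasurable_comp_restrict hf hKi))
    (h2.sub (aestronglyMeasurable_comp_restrict hg hKi)) one_le_two)
  congr 1
  funext x
  simp only [comp, Pi.add_apply]
  ring

/-- For one small `t`, the spinor at height `t` is continuous on the compact set `K`, hence in
`L²(K)`, and differs from the boundary value by a function of finite norm. -/
theorem IsL2BoundaryValue.eLpNorm_comp_lt_top {ψ : Fin S.n → Y → ℂ} {f : Y → ℂ}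
    (h : S.IsL2BoundaryValue ψ f) (hψ : S.IsContinuousInside ψ)
    (hf : AEStronglyMeasurable f S.bdryMeasure) {i : Fin S.n} {K : Set ℝ} (hK : IsCompact K)
    (hKi : K ⊆ S.bdryDom i) :
    eLpNorm (fun x : ℝ => S.comp f i (S.pt i x)) 2 (volume.restrict K) < ⊤ := by
  obtain ⟨t, ht1, ht2⟩ := ((h i K hK hKi).eventually_lt_const ENNReal.zero_lt_top |>.and
    (hψ.eventually_continuousOn hK hKi)).exists
  have hu : MemLp (fun x : ℝ => ψ i (S.pt i (x + t * Complex.I))) 2 (volume.restrict K) := by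
    have : IsFiniteMeasure (volume.restrict K) := ⟨by simpa using hK.measure_lt_top⟩
    obtain ⟨C, hC⟩ := hK.exists_bound_of_continuousOn ht2
    exact .of_bound (ht2.aestronglyMeasurable hK.measurableSet) C
      ((ae_restrict_mem hK.measurableSet).mono hC)
  have hd : MemLp (fun x : ℝ => ψ i (S.pt i (x + t * Complex.I)) - S.comp f i (S.pt i x)) 2
      (volume.restrict K) :=
    ⟨hu.1.sub (aestronglyMeasurable_comp_restrict hf hKi), ht1⟩
  convert (hu.sub hd).2 using 2
  funext x
  simp

/-- `G` is only assumed continuous inside, not holomorphic, so that the lemma also serves for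
conjugates of holomorphic functions. -/
theorem IsL2BoundaryValue.mul {ψ : Fin S.n → Y → ℂ} {f : Y → ℂ}
    (h : S.IsL2BoundaryValue ψ f) (hψ : S.IsContinuousInside ψ)
    (hf : AEStronglyMeasurable f S.bdryMeasure) {G a : Y → ℂ}
    (hG : S.IsContinuousInside fun _ => G) {C : ℝ}
    (hC : ∀ x ∈ halfPlaneModel.interior Y, ‖G x‖ ≤ C)
    (hGa : ∀ i, ∀ᵐ x : ℝ, (x : ℂ) ∈ S.dom i →
      Tendsto (fun t : ℝ => G (S.pt i (x + t * Complex.I))) (𝓝[>] 0) (𝓝 (a (S.pt i x)))) :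
    S.IsL2BoundaryValue (fun i x => G x * ψ i x) fun x => a x * f x := by
  intro i K hK hKi
  have hbd : ∀ᶠ t : ℝ in 𝓝[>] 0, ∀ x ∈ K, ‖G (S.pt i (x + t * Complex.I))‖ ≤ C := by
    filter_upwards [S.eventually_add_mem_dom hK hKi] with t ht x hx
    exact hC _ ((S.pt_mem_interior_iff (ht x hx).1).2 (ht x hx).2)
  have hlim : ∀ᵐ x : ℝ ∂volume.restrict K,
      Tendsto (fun t : ℝ => G (S.pt i (x + t * Complex.I))) (𝓝[>] 0) (𝓝 (a (S.pt i x))) := by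
    rw [ae_restrict_iff' hK.measurableSet]
    filter_upwards [hGa i] with x hx hxK using hx (hKi x hxK)
  have habd : ∀ᵐ x : ℝ ∂volume.restrict K, ‖a (S.pt i x)‖ ≤ C := by
    filter_upwards [hlim, ae_restrict_mem hK.measurableSet] with x hx hxK
    exact le_of_tendsto hx.norm (hbd.mono fun t ht => ht x hxK)
  have key := tendsto_eLpNorm_mul_sub_mul one_le_two ENNReal.ofNat_ne_top
    (hG.eventually_aestronglyMeasurable hK hKi) (hψ.eventually_aestronglyMeasurable hK hKi)
    ⟨aestronglyMeasurable_comp_restrict hf hKi, h.eLpNorm_comp_lt_top hψ hf hK hKi⟩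
    (hbd.mono fun t ht => (ae_restrict_mem hK.measurableSet).mono ht) habd hlim (h i K hK hKi)
  refine key.congr fun t => ?_
  congr 1
  funext x
  simp only [comp]
  ring

end

end SpinStructure

/-! ### Holomorphic spinors as a module over holomorphic functions. -/

namespace SpinStructure

section

variable {Y : Type*} [TopologicalSpace Y] [ChartedSpace ClosedHalfPlane Y] {S : SpinStructure Y}

theorem IsHolomorphicSpinor.add {ψ φ : Fin S.n → Y → ℂ} (h : S.IsHolomorphicSpinor ψ)
    (h' : S.IsHolomorphicSpinor φ) : S.IsHolomorphicSpinor fun i x => ψ i x + φ i x :=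
  ⟨fun i j x hx hxi => by simp only [h.1 i j x hx hxi, h'.1 i j x hx hxi, mul_add],
    fun i => (h.2 i).add (h'.2 i)⟩

variable [IsManifold halfPlaneModel ω Y]

theorem differentiableOn_comp_pt {F : Y → ℂ}
    (hF : MDifferentiableOn halfPlaneModel 𝓘(ℂ) F (halfPlaneModel.interior Y)) (i : Fin S.n) :
    DifferentiableOn ℂ (fun z => F (S.pt i z)) (S.dom i ∩ {z | 0 < z.im}) := by
  have h1 := ((S.contMDiffOn_pt i).mdifferentiableOn (by simp)).mono
    (inter_subset_left (t := {z : ℂ | 0 < z.im}))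
  exact mdifferentiableOn_iff_differentiableOn.1 <|
    hF.comp h1 fun z hz => (S.pt_mem_interior_iff hz.1).2 hz.2

theorem IsHolomorphicSpinor.mul {ψ : Fin S.n → Y → ℂ} (h : S.IsHolomorphicSpinor ψ) {F : Y → ℂ}
    (hF : MDifferentiableOn halfPlaneModel 𝓘(ℂ) F (halfPlaneModel.interior Y)) :
    S.IsHolomorphicSpinor fun i x => F x * ψ i x :=
  ⟨fun i j x hx hxi => by simp only [h.1 i j x hx hxi, mul_left_comm],
    fun i => (differentiableOn_comp_pt hF i).mul (h.2 i)⟩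

omit [IsManifold halfPlaneModel ω Y] in
theorem isHolomorphicBoundaryValue_const (c : ℂ) : S.IsHolomorphicBoundaryValue fun _ => c :=
  ⟨fun _ => c, mdifferentiableOn_const, ⟨‖c‖, fun _ _ => le_rfl⟩,
    fun _ => .of_forall fun _ _ => tendsto_const_nhds⟩

end

end SpinStructure

/-! ### Algebra of multiplication operators. -/

namespace LInfLoop

section

variable {Y : Type*} [MeasurableSpace Y] {μ : Measure Y}

theorem coeFn_mulOp (g : LInfLoop μ) (f : Lp (EuclideanSpace ℂ (Fin 2)) 2 μ) :
    g.mulOp f =ᵐ[μ] fun x => Matrix.toEuclideanCLM (n := Fin 2) (𝕜 := ℂ) (g.toFun x) (f x) := by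
  refine (ContinuousLinearMap.coeFn_holder (r := 2) (ContinuousLinearMap.id ℂ
    (EuclideanSpace ℂ (Fin 2) →L[ℂ] EuclideanSpace ℂ (Fin 2)))
    g.memLp_toEuclideanCLM.toLp f).trans ?_
  filter_upwards [g.memLp_toEuclideanCLM.coeFn_toLp] with x hx
  rw [hx]
  rfl

theorem mulOp_apply (g : LInfLoop μ) (f : Lp (EuclideanSpace ℂ (Fin 2)) 2 μ) :
    ∀ᵐ x ∂μ, ∀ k, g.mulOp f x k = g.toFun x k 0 * f x 0 + g.toFun x k 1 * f x 1 := by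
  filter_upwards [g.coeFn_mulOp f] with x hx k
  rw [hx, Matrix.ofLp_toEuclideanCLM, Matrix.mulVec, dotProduct, Fin.sum_univ_two]

theorem mulOp_mul (g h : LInfLoop μ) (f : Lp (EuclideanSpace ℂ (Fin 2)) 2 μ) :
    (g.mul h).mulOp f = g.mulOp (h.mulOp f) := by
  apply Lp.ext
  filter_upwards [(g.mul h).coeFn_mulOp f, g.coeFn_mulOp (h.mulOp f), h.coeFn_mulOp f]
    with x h1 h2 h3
  rw [h1, h2, h3, mul, map_mul]
  rfl

theorem inner_mulOp_left (g : LInfLoop μ) (u v : Lp (EuclideanSpace ℂ (Fin 2)) 2 μ) :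
    inner ℂ (g.mulOp u) v = inner ℂ u (g.adj.mulOp v) := by
  rw [L2.inner_def, L2.inner_def]
  apply integral_congr_ae
  filter_upwards [g.coeFn_mulOp u, g.adj.coeFn_mulOp v] with x h1 h2
  have h3 : g.adj.toFun x = star (g.toFun x) := rfl
  rw [h1, h2, h3, map_star, ContinuousLinearMap.star_eq_adjoint, ContinuousLinearMap.adjoint_inner_right]

/-- The constant matrix valued functions. -/
def const (μ : Measure Y) (A : Matrix (Fin 2) (Fin 2) ℂ) : LInfLoop μ where
  toFun _ := A
  memLp i j := memLp_top_const (A i j)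

end

end LInfLoop

/-! ### Invariance of the Hardy spaces and the Toeplitz identity. -/

namespace SpinStructure

section

variable {Y : Type*} [TopologicalSpace Y] [ChartedSpace ClosedHalfPlane Y] [MeasurableSpace Y]
  {S : SpinStructure Y}

theorem aestronglyMeasurable_apply (f : S.Spinors) (k : Fin 2) :
    AEStronglyMeasurable (fun x => f x k) S.bdryMeasure :=
  (EuclideanSpace.proj (𝕜 := ℂ) k).continuous.comp_aestronglyMeasurable (Lp.aestronglyMeasurable f)

/-- Since `hPlus` and `hMinus` are closures of spans, invariance under a bounded operator need only
be checked on actual boundary values. -/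
theorem map_mem_topologicalClosure_span {E : Type*} [NormedAddCommGroup E] [NormedSpace ℂ E]
    {s : Set E} (T : E →L[ℂ] E) (hT : ∀ f ∈ s, T f ∈ s) {f : E}
    (hf : f ∈ (Submodule.span ℂ s).topologicalClosure) :
    T f ∈ (Submodule.span ℂ s).topologicalClosure := by
  have h : (Submodule.span ℂ s).topologicalClosure ≤
      (Submodule.span ℂ s).topologicalClosure.comap (T : E →ₗ[ℂ] E) := by
    refine Submodule.topologicalClosure_minimal _ (Submodule.span_le.2 fun x hx => ?_) ?_
    · exact Submodule.le_topologicalClosure _ (Submodule.subset_span (hT x hx))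
    · exact (Submodule.isClosed_topologicalClosure _).preimage T.continuous
  exact h hf

/-- All entries of `g` are boundary values of bounded holomorphic functions. -/
def IsHolomorphicLoop (g : LInfLoop S.bdryMeasure) : Prop :=
  ∀ i j, S.IsHolomorphicBoundaryValue fun x => g.toFun x i j

variable [BorelSpace Y] [IsManifold halfPlaneModel ω Y]

theorem IsHolomorphicLoop.mulOp_mem_hPlus {g : LInfLoop S.bdryMeasure}
    (hg : S.IsHolomorphicLoop g) {f : S.Spinors} (hf : f ∈ S.hPlus) : g.mulOp f ∈ S.hPlus := by
  refine map_mem_topologicalClosure_span g.mulOp ?_ hf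
  rintro f ⟨ψ, hψ⟩
  choose F hF hFb hFg using hg
  choose C hC using hFb
  have hc := fun k => (hψ k).1.isContinuousInside
  have hFc : ∀ k j, S.IsContinuousInside fun _ => F k j :=
    fun k j i => (differentiableOn_comp_pt (hF k j) i).continuousOn
  have hm := fun k j => (g.memLp k j).1.mul (aestronglyMeasurable_apply f j)
  have hb : ∀ k j, S.IsL2BoundaryValue (fun i x => F k j x * ψ j i x)
      fun x => g.toFun x k j * f x j := fun k j => (hψ j).2.mul (hc j) (aestronglyMeasurable_apply f j) (hFc k j) (hC k j)
    (hFg k j)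
  refine ⟨fun k i x => F k 0 x * ψ 0 i x + F k 1 x * ψ 1 i x, fun k =>
    ⟨((hψ 0).1.mul (hF k 0)).add ((hψ 1).1.mul (hF k 1)), ?_⟩⟩
  refine ((hb k 0).add (hb k 1) ((hFc k 0).mul (hc 0)) ((hFc k 1).mul (hc 1)) (hm k 0)
    (hm k 1)).congr ?_
  filter_upwards [g.mulOp_apply f] with x hx using (hx k).symm

/-- Generators of `hMinus` are boundary values of conjugates of holomorphic spinors, and the entries
of `g*` are conjugates of holomorphic functions. The product is the conjugate of a holomorphic
spinor; the indices of `F` are transposed because of the adjoint. -/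
theorem IsHolomorphicLoop.adj_mulOp_mem_hMinus {g : LInfLoop S.bdryMeasure}
    (hg : S.IsHolomorphicLoop g) {f : S.Spinors} (hf : f ∈ S.hMinus) :
    g.adj.mulOp f ∈ S.hMinus := by
  refine map_mem_topologicalClosure_span g.adj.mulOp ?_ hf
  rintro f ⟨ψ, hψ⟩
  choose F hF hFb hFg using hg
  choose C hC using hFb
  have hc := fun k => (hψ k).1.isContinuousInside.conj
  have hFc : ∀ k j, S.IsContinuousInside fun _ x => conj (F k j x) := fun k j =>
    IsContinuousInside.conj fun i => (differentiableOn_comp_pt (hF k j) i).continuousOn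
  have hm := fun k j => (g.adj.memLp k j).1.mul (aestronglyMeasurable_apply f j)
  have hb : ∀ k j, S.IsL2BoundaryValue (fun i x => conj (F j k x) * conj (ψ j i x))
      fun x => g.adj.toFun x k j * f x j := fun k j =>
    (hψ j).2.mul (hc j) (aestronglyMeasurable_apply f j) (hFc j k)
      (fun x hx => (RCLike.norm_conj _).trans_le (hC j k x hx)) fun i => by
        filter_upwards [hFg j k i] with x hx hxi
        exact (Complex.continuous_conj.tendsto _).comp (hx hxi)
  refine ⟨fun k i x => F 0 k x * ψ 0 i x + F 1 k x * ψ 1 i x, fun k =>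
    ⟨((hψ 0).1.mul (hF 0 k)).add ((hψ 1).1.mul (hF 1 k)), ?_⟩⟩
  simp only [map_add, map_mul]
  refine ((hb k 0).add (hb k 1) ((hFc 0 k).mul (hc 0)) ((hFc 1 k).mul (hc 1)) (hm k 0)
    (hm k 1)).congr ?_
  filter_upwards [g.adj.mulOp_apply f] with x hx using (hx k).symm

omit [BorelSpace Y] [IsManifold halfPlaneModel ω Y] in
/-- If `P` is a projection such that holomorphic loops preserve its range and their adjoints preserve
its kernel, then the Toeplitz operators of `g₁*` and `g₂` multiply whenever the first row of `g₁` and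
the second row of `g₂` are holomorphic. -/
theorem blockA_adj_mul_and_blockB_blockC {V : Submodule ℂ S.Spinors}
    {P : S.Spinors →L[ℂ] S.Spinors} (hPV : ∀ f, P f ∈ V) (hP : ∀ f ∈ V, P f = f)
    (hV : ∀ h, S.IsHolomorphicLoop h → ∀ f ∈ V, h.mulOp f ∈ V)
    (hK : ∀ h, S.IsHolomorphicLoop h → ∀ f, P f = 0 → P (h.adj.mulOp f) = 0)
    {g₁ g₂ : LInfLoop S.bdryMeasure}
    (h₁ : ∀ j, S.IsHolomorphicBoundaryValue fun x => g₁.toFun x 0 j)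
    (h₂ : ∀ j, S.IsHolomorphicBoundaryValue fun x => g₂.toFun x 1 j) :
    (g₁.adj.mul g₂).blockA P = g₁.adj.blockA P ∘L g₂.blockA P ∧
      g₁.adj.blockB P ∘L g₂.blockC P = 0 := by
  have hPP : ∀ f, P (P f) = P f := fun f => hP _ (hPV f)
  set R := LInfLoop.const S.bdryMeasure !![0, 0; 0, 1] with hR
  set T := LInfLoop.const S.bdryMeasure !![1, 0; 0, 0] with hT
  have hRh : S.IsHolomorphicLoop R := fun i j => isHolomorphicBoundaryValue_const _
  have hRadj : R.adj = R := by
    simp only [hR, LInfLoop.adj, LInfLoop.const]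
    congr 1
    funext x
    ext i j
    fin_cases i <;> fin_cases j <;> simp
  -- `R` preserves the range of `P` and `R = R*` preserves its kernel, so `R` commutes with `P`.
  have hRP : ∀ f, P (R.mulOp f) = R.mulOp (P f) := fun f => by
    have h0 : P (R.mulOp (f - P f)) = 0 := by
      have := hK R hRh (f - P f) (by rw [map_sub, hPP, sub_self])
      rwa [hRadj] at this
    rw [map_sub, map_sub, sub_eq_zero, hP _ (hV R hRh _ (hPV f))] at h0
    exact h0
  have hE : S.IsHolomorphicLoop (R.mul g₂) := fun i j => by
    fin_cases i
    · simpa [hR, LInfLoop.mul, LInfLoop.const, Matrix.vecMul, dotProduct] using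
        isHolomorphicBoundaryValue_const (S := S) 0
    · simpa [hR, LInfLoop.mul, LInfLoop.const, Matrix.vecMul, dotProduct] using h₂ j
  have hD : S.IsHolomorphicLoop (T.mul g₁) := fun i j => by
    fin_cases i
    · simpa [hT, LInfLoop.mul, LInfLoop.const, Matrix.vecMul, dotProduct] using h₁ j
    · simpa [hT, LInfLoop.mul, LInfLoop.const, Matrix.vecMul, dotProduct] using
        isHolomorphicBoundaryValue_const (S := S) 0
  have key : ∀ u ∈ V, P (g₁.adj.mulOp (g₂.mulOp u - P (g₂.mulOp u))) = 0 := by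
    intro u hu
    set v := g₂.mulOp u - P (g₂.mulOp u) with hv
    have hPv : P v = 0 := by rw [hv, map_sub, hPP, sub_self]
    -- `R g₂` keeps only the holomorphic row of `g₂`, so `R g₂ u` lies in `V` and is fixed by `P`.
    have hRv : R.mulOp v = 0 := by
      rw [hv, map_sub, ← hRP, ← LInfLoop.mulOp_mul, hP _ (hV _ hE u hu), sub_self]
    -- As `v` has no second component, `g₁*` acts on it through its first column alone, the
    -- conjugate of the first row of `g₁`; this is also the first column of `(T g₁)*`.
    have hTv : g₁.adj.mulOp v = (T.mul g₁).adj.mulOp v := by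
      apply Lp.ext
      have h0 := Lp.coeFn_zero (EuclideanSpace ℂ (Fin 2)) 2 S.bdryMeasure
      rw [← hRv] at h0
      filter_upwards [h0, R.mulOp_apply v, g₁.adj.mulOp_apply v, (T.mul g₁).adj.mulOp_apply v]
        with x hx0 hxR hx1 hx2
      have hv1 : v x 1 = 0 := by
        have := hxR 1
        rw [hx0] at this
        simpa [hR, LInfLoop.const] using this.symm
      ext k
      rw [hx1, hx2, hv1]
      simp [hT, LInfLoop.adj, LInfLoop.mul, LInfLoop.const, Matrix.vecMul, dotProduct]
    rw [hTv]
    exact hK _ hD v hPv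
  constructor
  · ext1 f
    have := key (P f) (hPV f)
    rw [map_sub, map_sub, sub_eq_zero] at this
    simpa [LInfLoop.blockA, LInfLoop.mulOp_mul, hPP] using this
  · ext1 f
    have h1 := key (P f) (hPV f)
    have h2 : P (g₂.mulOp (P f) - P (g₂.mulOp (P f))) = 0 := by rw [map_sub, hPP, sub_self]
    simpa [LInfLoop.blockB, LInfLoop.blockC, h2, hPP] using h1

end

end SpinStructure

theorem theorem4p4
    {Y : Type*} [TopologicalSpace Y] [T2Space Y] [CompactSpace Y] [ConnectedSpace Y]
    [ChartedSpace ClosedHalfPlane Y] [IsManifold halfPlaneModel ω Y]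
    [MeasurableSpace Y] [BorelSpace Y]
    (hbdry : (halfPlaneModel.boundary Y).Nonempty)
    (S : SpinStructure Y) (g₁ g₂ : LInfLoop S.bdryMeasure)
    (hdet₁ : ∀ᵐ x ∂S.bdryMeasure, (g₁.toFun x).det = 1)
    (hdet₂ : ∀ᵐ x ∂S.bdryMeasure, (g₂.toFun x).det = 1)
    (ha₁ : S.IsHolomorphicBoundaryValue fun x => g₁.toFun x 0 0)
    (hb₁ : S.IsHolomorphicBoundaryValue fun x => g₁.toFun x 0 1)
    (hc₂ : S.IsHolomorphicBoundaryValue fun x => g₂.toFun x 1 0)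
    (hd₂ : S.IsHolomorphicBoundaryValue fun x => g₂.toFun x 1 1) :
    ((g₁.adj.mul g₂).blockA S.projPlus = g₁.adj.blockA S.projPlus ∘L g₂.blockA S.projPlus ∧
      g₁.adj.blockB S.projPlus ∘L g₂.blockC S.projPlus = 0) ∧
    ∀ P : S.Spinors →L[ℂ] S.Spinors, S.IsPolarization P →
      (g₁.adj.mul g₂).blockA P = g₁.adj.blockA P ∘L g₂.blockA P ∧
      g₁.adj.blockB P ∘L g₂.blockC P = 0 := by
  have h₁ : ∀ j, S.IsHolomorphicBoundaryValue fun x => g₁.toFun x 0 j :=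
    Fin.forall_fin_two.2 ⟨ha₁, hb₁⟩
  have h₂ : ∀ j, S.IsHolomorphicBoundaryValue fun x => g₂.toFun x 1 j :=
    Fin.forall_fin_two.2 ⟨hc₂, hd₂⟩
  refine ⟨?_, fun P hP => SpinStructure.blockA_adj_mul_and_blockB_blockC hP.1 hP.2.1
    (fun h hh f hf => hh.mulOp_mem_hPlus hf)
    (fun h hh f hf => (hP.2.2 _).2 (hh.adj_mulOp_mem_hMinus ((hP.2.2 f).1 hf))) h₁ h₂⟩
  have : CompleteSpace S.hPlus := Submodule.topologicalClosure.completeSpace _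
  refine SpinStructure.blockA_adj_mul_and_blockB_blockC (V := S.hPlus)
    (fun f => S.hPlus.starProjection_apply_mem f)
    (fun f hf => Submodule.starProjection_eq_self_iff.2 hf)
    (fun h hh f hf => hh.mulOp_mem_hPlus hf) (fun h hh f hf => ?_) h₁ h₂
  -- The kernel of the orthogonal projection is the orthogonal complement of `hPlus`. It is
  -- preserved by `h*` because `h` preserves `hPlus`.
  have hf' : f ∈ S.hPlusᗮ := (Submodule.starProjection_apply_eq_zero_iff S.hPlus).1 hf
  refine (Submodule.starProjection_apply_eq_zero_iff S.hPlus).2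
    ((Submodule.mem_orthogonal _ _).2 fun u hu => ?_)
  rw [← LInfLoop.inner_mulOp_left]
  exact (Submodule.mem_orthogonal _ _).1 hf' _ (hh.mulOp_mem_hPlus hu)
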